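/- Let $K$ be a field, $A$ a Noetherian $K$-algebra and $S=A[x_0,\dots,x_n]$ with its standard grading ($\deg a=0$ for $a\in A$) and the variables ordered $x_0<\dots<x_n$. For a term $x^\alpha\neq 1$ let $\min(x^\alpha)$ be the smallest variable dividing it, and put $\min(1)=x_n$. The Pommaret cone of $x^\alpha$ is the set of terms $x^\alpha x^\delta$ where $x^\delta$ involves only variables $x_i\le\min(x^\alpha)$. Let $J\subseteq S$ be a nonzero quasi-stable monomial ideal, that is, a monomial ideal possessing a (finite) Pommaret basis $\mathcal P(J)$: a finite set of terms generating $J$ such that the set of terms in $J$ is the disjoint union of the Pommaret cones of the elements of $\mathcal P(J)$. Let $\mathcal N(J)$ be the set of terms not in $J$. Let $G=\{f_\alpha \mid x^\alpha\in\mathcal P(J)\}\subset S$ be a $\mathcal P(J)$-marked basis: each $f_\alpha$ is homogeneous, the coefficient of $x^\alpha$ in $f_\alpha$ is $1$, all terms in the support of $f_\alpha-x^\alpha$ lie in $\mathcal N(J)$, and, with $I=(G)$, one has $S_s=I_s\oplus\langle \mathcal N(J)_s\rangle^A$ as $A$-modules for every degree $s\ge 0$, where $\langle \mathcal N(J)_s\rangle^A$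 is the $A$-span of the terms of degree $s$ in $\mathcal N(J)$. Let $\beta_{0,j}^{(k)}$ be the number of terms $x^\alpha\in\mathcal P(J)$ with $\deg(x^\alpha)=j$ and $\min(x^\alpha)=x_k$ (so $\beta_{0,j}^{(k)}=0$ for $j<0$), and let $D=\min\{k \mid x_k=\min(x^\alpha)\text{ for some }x^\alpha\in\mathcal P(J)\}$. Then $I$ possesses a graded free resolution $$0\to\bigoplus_j S(-j)^{r_{n-D,j}}\to\cdots\to\bigoplus_j S(-j)^{r_{1,j}}\to\bigoplus_j S(-j)^{r_{0,j}}\to I\to 0$$ by free modules of finite rank, with all maps homogeneous of degree $0$, of length exactly $n-D$ (the leftmost free module has positive rank), where $$r_{i,j}=\sum_{k=0}^{n-i}\binom{n-k}{i}\,\beta_{0,j-i}^{(k)}\qquad (0\le i\le n-D,\ j\ge 0),$$ and the same formula gives $r_{i,j}=0$ for all $i>n-D$. -/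

import Mathlib

/-! Terms `x^α` in the variables `x_0 < x_1 < ⋯ < x_n` are represented by their exponent vectors
`α : Fin (n + 1) →₀ ℕ`; the polynomial ring `A[x_0, …, x_n]` is `MvPolynomial (Fin (n + 1)) A`. -/

noncomputable section

/-- The index of the smallest variable occurring in the term `x^α`, with the convention
`min(1) = x_n` (so that every variable is multiplicative for the term `1`). -/
def minVar {n : ℕ} (α : Fin (n + 1) →₀ ℕ) : Fin (n + 1) :=
  if h : α.support.Nonempty then α.support.min' h else Fin.last n

/-- The Pommaret cone of `x^α`: all `x^α x^δ` where `x^δ` involves only the multiplicative variables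
`x_i ≤ min(x^α)` of `x^α`. -/
def pommaretCone {n : ℕ} (α : Fin (n + 1) →₀ ℕ) : Set (Fin (n + 1) →₀ ℕ) :=
  {γ | ∃ δ : Fin (n + 1) →₀ ℕ, (∀ i ∈ δ.support, i ≤ minVar α) ∧ γ = α + δ}

/-- The set of terms lying in the ideal `J`. -/
def termsIn {n : ℕ} {A : Type*} [CommRing A] (J : Ideal (MvPolynomial (Fin (n + 1)) A)) :
    Set (Fin (n + 1) →₀ ℕ) :=
  {γ | MvPolynomial.monomial γ (1 : A) ∈ J}

/-- The finite set of terms `P` is a Pommaret basis of the ideal `J`: it generates `J`, and the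
terms in `J` are the disjoint union of the Pommaret cones of the elements of `P`. -/
structure IsPommaretBasis {n : ℕ} {A : Type*} [CommRing A] (P : Finset (Fin (n + 1) →₀ ℕ))
    (J : Ideal (MvPolynomial (Fin (n + 1)) A)) : Prop where
  span_eq : Ideal.span ((fun α => MvPolynomial.monomial α (1 : A)) '' (P : Set _)) = J
  iUnion_cone : ⋃ α ∈ P, pommaretCone α = termsIn J
  disjoint_cone : (P : Set (Fin (n + 1) →₀ ℕ)).PairwiseDisjoint pommaretCone

/-- The family `f = (f_α)_{x^α ∈ P}` is a `P`-marked set, with `J` the monomial ideal generated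
by `P`: `f_α` is homogeneous (of degree `|α|`), its head term `x^α` has coefficient `1`, and all
other terms of `f_α` lie outside `J`. -/
structure IsMarkedSet {n : ℕ} {A : Type*} [CommRing A] (P : Finset (Fin (n + 1) →₀ ℕ))
    (J : Ideal (MvPolynomial (Fin (n + 1)) A)) (f : P → MvPolynomial (Fin (n + 1)) A) : Prop where
  homogeneous : ∀ α : P, (f α).IsHomogeneous (Finsupp.degree (α : Fin (n + 1) →₀ ℕ))
  head_coeff : ∀ α : P, (f α).coeff (α : Fin (n + 1) →₀ ℕ) = 1
  tail : ∀ α : P, ∀ γ ∈ (f α - MvPolynomial.monomial (α : Fin (n + 1) →₀ ℕ) (1 : A)).support,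
    γ ∉ termsIn J

/-- The degree `s` component `I_s` of an ideal, as an `A`-module. -/
def idealComponent {n : ℕ} {A : Type*} [CommRing A] (I : Ideal (MvPolynomial (Fin (n + 1)) A))
    (s : ℕ) : Submodule A (MvPolynomial (Fin (n + 1)) A) :=
  I.restrictScalars A ⊓ MvPolynomial.homogeneousSubmodule (Fin (n + 1)) A s

/-- The `A`-module spanned by the terms of degree `s` that do not belong to `J`. -/
def normalComponent {n : ℕ} {A : Type*} [CommRing A] (J : Ideal (MvPolynomial (Fin (n + 1)) A))
    (s : ℕ) : Submodule A (MvPolynomial (Fin (n + 1)) A) :=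
  Submodule.span A
    ((fun γ => MvPolynomial.monomial γ (1 : A)) '' {γ | γ ∉ termsIn J ∧ Finsupp.degree γ = s})

/-- A `P`-marked basis: a `P`-marked set such that, for every degree `s`, the module of forms of
degree `s` is the direct sum of `(f_α)_s` and of the span of the terms of degree `s` outside `J`. -/
structure IsMarkedBasis {n : ℕ} {A : Type*} [CommRing A] (P : Finset (Fin (n + 1) →₀ ℕ))
    (J : Ideal (MvPolynomial (Fin (n + 1)) A)) (f : P → MvPolynomial (Fin (n + 1)) A) : Prop
    extends IsMarkedSet P J f where
  disjoint : ∀ s : ℕ, Disjoint (idealComponent (Ideal.span (Set.range f)) s) (normalComponent J s)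
  sup_eq : ∀ s : ℕ, idealComponent (Ideal.span (Set.range f)) s ⊔ normalComponent J s =
    MvPolynomial.homogeneousSubmodule (Fin (n + 1)) A s

/-- The number `β_{0,j}^{(k)}` of terms in `P` of degree `j` whose smallest variable is `x_k`. -/
def termCount {n : ℕ} (P : Finset (Fin (n + 1) →₀ ℕ)) (k j : ℕ) : ℕ :=
  (P.filter fun α => Finsupp.degree α = j ∧ (minVar α : ℕ) = k).card

/-- `r_{i,j} = ∑_{k=0}^{n-i} C(n-k, i) β_{0,j-i}^{(k)}`, where `β_{0,j-i}^{(k)} = 0` if `j < i`. -/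
def resolutionRank {n : ℕ} (P : Finset (Fin (n + 1) →₀ ℕ)) (i j : ℕ) : ℕ :=
  if i ≤ j then ∑ k ∈ Finset.range (n + 1 - i), (n - k).choose i * termCount P k (j - i) else 0

/-- The free module `⨁_j S(-j)^{r_j}` over `S = A[x_0, …, x_n]`. -/
abbrev ShiftedFree (n : ℕ) (A : Type*) [CommRing A] (r : ℕ → ℕ) : Type _ :=
  (Σ j : ℕ, Fin (r j)) →₀ MvPolynomial (Fin (n + 1)) A

/-- The degree `s` component of `⨁_j S(-j)^{r_j}`: the coordinates in `S(-j)` are forms of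
degree `s - j` (zero if `s < j`). -/
def ShiftedFree.component {n : ℕ} {A : Type*} [CommRing A] (r : ℕ → ℕ) (s : ℕ) :
    Set (ShiftedFree n A r) :=
  {v | ∀ p, (p.1 ≤ s → (v p).IsHomogeneous (s - p.1)) ∧ (s < p.1 → v p = 0)}

/-- `⋯ → F_1 → F_0 → I → 0`, with `F_i = ⨁_j S(-j)^{r_{i,j}}`, differentials
`d i : F_{i+1} → F_i` and augmentation `ε`, is a graded free resolution of the ideal `I` by free
modules of finite rank, and it has length `L`: `F_L ≠ 0` and `F_i = 0` for all `i > L`. -/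
structure IsGradedFreeResolution {n : ℕ} {A : Type*} [CommRing A]
    (I : Ideal (MvPolynomial (Fin (n + 1)) A)) (r : ℕ → ℕ → ℕ) (L : ℕ)
    (ε : ShiftedFree n A (r 0) →ₗ[MvPolynomial (Fin (n + 1)) A] I)
    (d : ∀ i, ShiftedFree n A (r (i + 1)) →ₗ[MvPolynomial (Fin (n + 1)) A] ShiftedFree n A (r i)) :
    Prop where
  finite_rank : ∀ i, Finite (Σ j : ℕ, Fin (r i j))
  augmentation_degree : ∀ s, ∀ v ∈ ShiftedFree.component (r 0) s,
    ((ε v : I) : MvPolynomial (Fin (n + 1)) A).IsHomogeneous s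
  differential_degree : ∀ i s, ∀ v ∈ ShiftedFree.component (r (i + 1)) s,
    d i v ∈ ShiftedFree.component (r i) s
  augmentation_surjective : Function.Surjective ε
  exact_zero : Function.Exact (d 0) ε
  exact_succ : ∀ i, Function.Exact (d (i + 1)) (d i)
  top_ne_zero : ∃ j, r L j ≠ 0
  eq_zero_of_gt : ∀ i, L < i → ∀ j, r i j = 0

end

/-! The resolution comes from iterating one step: the syzygies of a marked basis again have a marked
basis. To make this iterable, the ideal case is embedded in the notion `MarkedModule`, for
submodules `U` of a graded free module. Two facts drive the step. Every element of `U` is a unique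
combination of the generators whose coefficients involve only multiplicative variables
(`exists_isMult_toU_eq`, `eq_zero_of_isMult`). Both rest on the colexicographic descent of cofactors
in `toColex_lt_of_add_eq_add`.

Hence the combinations with multiplicative coefficients are a complement of the kernel of `toU`. The
remaining terms `x^γ e_p` involve a nonmultiplicative variable; sorted by their largest variable
`x_k`, they form the disjoint cones of the heads `x_k e_p`. Rewriting each `x_k g_p`
multiplicatively gives the marked basis of the kernel (`syzygy`).

A generator with multiplicative index `m` thus yields one of degree one higher for each `k > m`,
with index `k`. Summing binomials over these `k` gives the ranks, and the strict growth of the index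
gives the length `n - D`. -/

noncomputable section

open MvPolynomial

/-! ### Terms in bounded variables and the reduction order. -/

/-- The term `x^δ` involves only variables `x_i` with `i ≤ m`. -/
def VarsLE {n : ℕ} (m : Fin (n + 1)) (δ : Fin (n + 1) →₀ ℕ) : Prop :=
  ∀ i ∈ δ.support, i ≤ m

theorem VarsLE.eq_zero {n : ℕ} {m i : Fin (n + 1)} {δ : Fin (n + 1) →₀ ℕ} (h : VarsLE m δ)
    (hi : m < i) : δ i = 0 := by
  by_contra h0
  exact absurd (h i (Finsupp.mem_support_iff.2 h0)) (not_le.2 hi)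

theorem VarsLE.zero {n : ℕ} (m : Fin (n + 1)) : VarsLE m (0 : Fin (n + 1) →₀ ℕ) := by
  simp [VarsLE]

/-- A term involving some variable `> m` is `x_k x^ε` with `k > m` its largest variable. -/
theorem exists_eq_single_add_of_not_varsLE {n : ℕ} {m : Fin (n + 1)} {δ : Fin (n + 1) →₀ ℕ}
    (h : ¬ VarsLE m δ) : ∃ k, m < k ∧ ∃ ε, VarsLE k ε ∧ δ = Finsupp.single k 1 + ε := by
  simp only [VarsLE, not_forall, not_le] at h
  obtain ⟨i, hi, hmi⟩ := h
  have hne : δ.support.Nonempty := ⟨i, hi⟩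
  have hk := δ.support.max'_mem hne
  set k := δ.support.max' hne with hkdef
  have hle : Finsupp.single k 1 ≤ δ := by
    rw [Finsupp.single_le_iff]
    exact Nat.one_le_iff_ne_zero.2 (Finsupp.mem_support_iff.1 hk)
  refine ⟨k, lt_of_lt_of_le hmi (δ.support.le_max' i hi), δ - Finsupp.single k 1, ?_,
    (add_tsub_cancel_of_le hle).symm⟩
  intro j hj
  apply δ.support.le_max'
  rw [Finsupp.mem_support_iff] at hj ⊢
  intro h0
  simp [h0] at hj

/-- The reduction order: if `x^{ζ+γ}` lies in the cone of `x^β`, say with cofactor `x^δ`, but `x^γ`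
does not, then `δ` is colexicographically smaller than `ζ`. -/
theorem toColex_lt_of_add_eq_add {n : ℕ} {m : Fin (n + 1)} {β γ δ ζ : Fin (n + 1) →₀ ℕ}
    (hβ : ∀ l, l < m → β l = 0) (hδ : VarsLE m δ) (h : ζ + γ = β + δ)
    (hγ : ∀ ε, VarsLE m ε → γ ≠ β + ε) : toColex δ < toColex ζ := by
  by_contra hlt
  rcases lt_or_eq_of_le (not_lt.1 hlt) with hlt | heq
  · rw [Finsupp.Colex.lt_iff] at hlt
    obtain ⟨k, hk, hkk⟩ := hlt
    simp only [ofColex_toColex] at hk hkk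
    have hkm : k ≤ m := hδ k (Finsupp.mem_support_iff.2 (by omega))
    have hpt : ∀ l, ζ l + γ l = β l + δ l := fun l => by
      simpa using DFunLike.congr_fun h l
    -- At the top difference `k ≤ m` the cofactor `δ` exceeds `ζ`. Below `k` the exponents of `β`
    -- vanish, and above `k` those of `γ` and `β` agree, so `x^β` divides `x^γ` with quotient in the
    -- variables up to `m`.
    have hle : β ≤ γ := fun l => by
      rcases lt_trichotomy l k with hl | rfl | hl
      · rw [hβ l (hl.trans_le hkm)]; exact Nat.zero_le _
      · have := hpt l; omega
      · have := hpt l; have := hk l hl; omega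
    refine hγ (γ - β) ?_ (add_tsub_cancel_of_le hle).symm
    intro l hl
    by_contra hml
    have hkl : k < l := hkm.trans_lt (not_le.1 hml)
    have h1 := hpt l
    have h2 := hk l hkl
    rw [Finsupp.mem_support_iff] at hl
    apply hl
    rw [Finsupp.tsub_apply]
    omega
  · have : ζ = δ := toColex_inj.1 heq
    subst this
    refine hγ 0 (VarsLE.zero m) ?_
    rw [add_comm ζ γ] at h
    simpa using add_right_cancel h

/-! ### Marked bases of submodules of free modules. -/

/-- A marked basis of a submodule `U` of the graded free module `⨁_b S(-deg b)`: the element `g p`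
has head term `x^(head p) e_(pos p)`, whose multiplicative variables are the `x_i` with
`i ≤ mult p`, and `U` is complementary to the span of the terms outside all the cones. -/
structure MarkedModule (n : ℕ) (A : Type*) [CommRing A] where
  B : Type
  P : Type
  [fintypeP : Fintype P]
  pos : P → B
  head : P → (Fin (n + 1) →₀ ℕ)
  mult : P → Fin (n + 1)
  degB : B → ℕ
  U : Submodule (MvPolynomial (Fin (n + 1)) A) (B →₀ MvPolynomial (Fin (n + 1)) A)
  g : P → B →₀ MvPolynomial (Fin (n + 1)) A
  head_eq_zero : ∀ p l, l < mult p → head p l = 0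
  cone_disjoint : ∀ p q δ ζ, pos p = pos q → VarsLE (mult p) δ → VarsLE (mult q) ζ →
    head p + δ = head q + ζ → p = q
  g_mem : ∀ p, g p ∈ U
  coeff_head : ∀ p, (g p (pos p)).coeff (head p) = 1
  coeff_tail : ∀ p q δ, VarsLE (mult q) δ → (g p (pos q)).coeff (head q + δ) ≠ 0 → q = p ∧ δ = 0
  g_degree : ∀ p b γ, (g p b).coeff γ ≠ 0 → γ.degree + degB b = (head p).degree + degB (pos p)
  -- This field and the next encode complementarity: restricting coefficients to the cones is
  -- injective on `U`, and has the same image on `U` as on the whole free module.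
  eq_zero_of_coeff : ∀ u ∈ U,
    (∀ p δ, VarsLE (mult p) δ → (u (pos p)).coeff (head p + δ) = 0) → u = 0
  exists_coeff_eq : ∀ v : B →₀ MvPolynomial (Fin (n + 1)) A, ∃ u ∈ U, ∀ p δ, VarsLE (mult p) δ →
    (u (pos p)).coeff (head p + δ) = (v (pos p)).coeff (head p + δ)

namespace MarkedModule

variable {n : ℕ} {A : Type*} [CommRing A] (M : MarkedModule n A)

instance : Fintype M.P := M.fintypeP

/-- The degree of the generator `g p`. -/
def degP (p : M.P) : ℕ := (M.head p).degree + M.degB (M.pos p)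

/-- The map from the free module on `P` sending the basis to the marked basis. -/
def toU : (M.P →₀ MvPolynomial (Fin (n + 1)) A) →ₗ[MvPolynomial (Fin (n + 1)) A]
    (M.B →₀ MvPolynomial (Fin (n + 1)) A) :=
  Finsupp.linearCombination _ M.g

theorem toU_mem (w) : M.toU w ∈ M.U := by
  rw [toU, Finsupp.linearCombination_apply]
  exact Submodule.sum_mem _ fun p _ => Submodule.smul_mem _ _ (M.g_mem p)

/-- Each coordinate of `w` involves only multiplicative variables. -/
def IsMult (w : M.P →₀ MvPolynomial (Fin (n + 1)) A) : Prop :=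
  ∀ p δ, (w p).coeff δ ≠ 0 → VarsLE (M.mult p) δ

theorem coeff_toU (w : M.P →₀ MvPolynomial (Fin (n + 1)) A) (b : M.B) (γ : Fin (n + 1) →₀ ℕ) :
    (M.toU w b).coeff γ = ∑ p, ∑ x ∈ Finset.HasAntidiagonal.antidiagonal γ,
      (w p).coeff x.1 * (M.g p b).coeff x.2 := by
  rw [toU, Finsupp.linearCombination_apply, Finsupp.sum_fintype _ _ (by simp),
    Finsupp.finsetSum_apply, coeff_sum]
  simp [coeff_mul]

theorem exists_of_coeff_toU_ne_zero {w : M.P →₀ MvPolynomial (Fin (n + 1)) A} {b : M.B}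
    {γ : Fin (n + 1) →₀ ℕ} (h : (M.toU w b).coeff γ ≠ 0) :
    ∃ p δ ζ, δ + ζ = γ ∧ (w p).coeff δ ≠ 0 ∧ (M.g p b).coeff ζ ≠ 0 := by
  rw [coeff_toU] at h
  obtain ⟨p, -, hp⟩ := Finset.exists_ne_zero_of_sum_ne_zero h
  obtain ⟨x, hx, hxp⟩ := Finset.exists_ne_zero_of_sum_ne_zero hp
  exact ⟨p, x.1, x.2, Finset.HasAntidiagonal.mem_antidiagonal.1 hx, left_ne_zero_of_mul hxp,
    right_ne_zero_of_mul hxp⟩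

/-- If the terms of `w` have degrees in `T`, so do those of its image. -/
theorem degree_mem_of_coeff_toU_ne_zero (T : Set ℕ) {w : M.P →₀ MvPolynomial (Fin (n + 1)) A}
    (hw : ∀ p δ, (w p).coeff δ ≠ 0 → δ.degree + M.degP p ∈ T) {b : M.B} {γ : Fin (n + 1) →₀ ℕ}
    (h : (M.toU w b).coeff γ ≠ 0) : γ.degree + M.degB b ∈ T := by
  obtain ⟨p, δ, ζ, rfl, hδ, hζ⟩ := M.exists_of_coeff_toU_ne_zero h
  have := hw p δ hδ
  rwa [degP, ← M.g_degree p b ζ hζ, ← add_assoc, ← map_add] at this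

/-- The terms contributing to a term in the cone of `p` are either its head multiple or come from
a colexicographically larger cofactor. -/
theorem eq_or_toColex_lt {p q : M.P} {δ ζ γ : Fin (n + 1) →₀ ℕ} (hδ : VarsLE (M.mult p) δ)
    (hζ : VarsLE (M.mult q) ζ) (h : ζ + γ = M.head p + δ) (hγ : (M.g q (M.pos p)).coeff γ ≠ 0) :
    (q = p ∧ ζ = δ ∧ γ = M.head p) ∨ toColex δ < toColex ζ := by
  by_cases hc : ∃ ε, VarsLE (M.mult p) ε ∧ γ = M.head p + ε
  · left
    obtain ⟨ε, hε, rfl⟩ := hc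
    obtain ⟨rfl, rfl⟩ := M.coeff_tail q p ε hε hγ
    rw [add_zero, add_comm _ δ] at h
    exact ⟨rfl, add_right_cancel h, add_zero _⟩
  · right
    push Not at hc
    exact toColex_lt_of_add_eq_add (M.head_eq_zero p) hδ h hc

/-- A colexicographically maximal cofactor `δ` in `w`, at `p`, leaves the term `head p + δ`
uncancelled: by `eq_or_toColex_lt` any other contribution to it needs a larger cofactor. -/
theorem eq_zero_of_isMult {w : M.P →₀ MvPolynomial (Fin (n + 1)) A} (hw : M.IsMult w)
    (h : M.toU w = 0) : w = 0 := by
  by_contra hne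
  let s : Finset (Σ _ : M.P, Fin (n + 1) →₀ ℕ) := Finset.univ.sigma fun p => (w p).support
  have hs : s.Nonempty := by
    obtain ⟨p, hp⟩ := Finsupp.ne_iff.1 hne
    obtain ⟨δ, hδ⟩ := MvPolynomial.ne_zero_iff.1 hp
    exact ⟨⟨p, δ⟩, by simpa [s] using hδ⟩
  obtain ⟨⟨p, δ⟩, hx, hmax⟩ := s.exists_max_image (fun x => toColex x.2) hs
  have hδ : (w p).coeff δ ≠ 0 := by simpa [s] using hx
  have hmax' : ∀ q ζ, (w q).coeff ζ ≠ 0 → ¬ toColex δ < toColex ζ := fun q ζ hζ =>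
    not_lt.2 (hmax ⟨q, ζ⟩ (by simpa [s] using hζ))
  have key := M.coeff_toU w (M.pos p) (M.head p + δ)
  rw [h, Finset.sum_eq_single p, Finset.sum_eq_single (δ, M.head p)] at key
  · simp [M.coeff_head, hδ.symm] at key
  · rintro ⟨ζ, γ⟩ hx hne
    by_contra h0
    have h1 := left_ne_zero_of_mul h0
    rcases M.eq_or_toColex_lt (hw p δ hδ) (hw p ζ h1) (Finset.HasAntidiagonal.mem_antidiagonal.1 hx)
      (right_ne_zero_of_mul h0) with ⟨-, rfl, rfl⟩ | h2
    · exact hne rfl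
    · exact hmax' _ _ h1 h2
  · intro h0
    exact absurd (Finset.HasAntidiagonal.mem_antidiagonal.2 (add_comm _ _)) h0
  · intro q _ hq
    refine Finset.sum_eq_zero fun x hx => ?_
    by_contra h0
    have h1 := left_ne_zero_of_mul h0
    rcases M.eq_or_toColex_lt (hw p δ hδ) (hw q x.1 h1) (Finset.HasAntidiagonal.mem_antidiagonal.1 hx)
      (right_ne_zero_of_mul h0) with ⟨rfl, -⟩ | h2
    · exact hq rfl
    · exact hmax' _ _ h1 h2
  · simp

/-- The vectors that agree, on all terms in the cones, with a multiplicative combination of the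
marked basis. -/
def reducible : Submodule A (M.B →₀ MvPolynomial (Fin (n + 1)) A) where
  carrier := {v | ∃ w, M.IsMult w ∧ ∀ p δ, VarsLE (M.mult p) δ →
    (M.toU w (M.pos p)).coeff (M.head p + δ) = (v (M.pos p)).coeff (M.head p + δ)}
  zero_mem' := ⟨0, by simp [IsMult], by simp⟩
  add_mem' := by
    rintro v v' ⟨w, hw, h⟩ ⟨w', hw', h'⟩
    refine ⟨w + w', fun p δ hδ => ?_, fun p δ hδ => by simp [h p δ hδ, h' p δ hδ]⟩
    by_cases h0 : (w p).coeff δ = 0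
    · exact hw' p δ (by simpa [h0] using hδ)
    · exact hw p δ h0
  smul_mem' := by
    rintro a v ⟨w, hw, h⟩
    refine ⟨(C a : MvPolynomial (Fin (n + 1)) A) • w, fun p δ hδ => ?_, fun p δ hδ => ?_⟩
    swap
    · rw [map_smul, Finsupp.smul_apply, smul_eq_mul, coeff_C_mul, h p δ hδ]
      simp
    simp only [Finsupp.smul_apply, smul_eq_mul, coeff_C_mul] at hδ
    exact hw p δ (right_ne_zero_of_mul hδ)

/-- `reducible` is only known to be an `A`-submodule, since a nonmultiplicative variable destroys
`IsMult`; that suffices to argue term by term. -/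
theorem mem_reducible_of_terms {v : M.B →₀ MvPolynomial (Fin (n + 1)) A}
    (h : ∀ b γ, (v b).coeff γ ≠ 0 → Finsupp.single b (monomial γ (1 : A)) ∈ M.reducible) :
    v ∈ M.reducible := by
  rw [← Finsupp.sum_single v]
  refine Submodule.sum_mem _ fun b _ => ?_
  rw [(v b).as_sum, ← Finsupp.singleAddHom_apply, map_sum]
  refine Submodule.sum_mem _ fun γ hγ => ?_
  have := M.reducible.smul_mem ((v b).coeff γ) (h b γ (mem_support_iff.1 hγ))
  rwa [Finsupp.smul_single, smul_monomial, smul_eq_mul, mul_one] at this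

theorem single_mem_reducible_of_not_mem_cone {b : M.B} {γ : Fin (n + 1) →₀ ℕ}
    (h : ∀ p δ, VarsLE (M.mult p) δ → M.pos p = b → γ ≠ M.head p + δ) :
    Finsupp.single b (monomial γ (1 : A)) ∈ M.reducible := by
  classical
  refine ⟨0, by simp [IsMult], fun p δ hδ => ?_⟩
  rw [Finsupp.single_apply]
  split_ifs with hb
  · simp [coeff_monomial, h p δ hδ hb.symm]
  · simp

/-- Induction on the cofactor, colex being a well-order in finitely many variables. Subtracting the
term from `x^δ g_p` cancels the head, and the cone terms that are left have smaller cofactors. -/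
theorem single_mem_reducible_of_mem_cone (x : Colex (Fin (n + 1) →₀ ℕ)) :
    ∀ p, VarsLE (M.mult p) (ofColex x) →
      Finsupp.single (M.pos p) (monomial (M.head p + ofColex x) (1 : A)) ∈ M.reducible := by
  classical
  induction x using WellFoundedLT.induction with
  | ind x ih =>
    intro p hx
    set δ := ofColex x with hδ
    have hmem : M.toU (Finsupp.single p (monomial δ 1)) ∈ M.reducible := by
      refine ⟨_, fun q ζ hζ => ?_, fun _ _ _ => rfl⟩
      rw [Finsupp.single_apply] at hζ
      split_ifs at hζ with hq
      · subst hq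
        rw [coeff_monomial] at hζ
        split_ifs at hζ with h
        · exact h ▸ hx
        · exact absurd rfl hζ
      · simp at hζ
    have hdiff : M.toU (Finsupp.single p (monomial δ 1)) -
        Finsupp.single (M.pos p) (monomial (M.head p + δ) (1 : A)) ∈ M.reducible := by
      refine M.mem_reducible_of_terms fun b γ hγ => ?_
      by_cases hc : ∀ q ζ, VarsLE (M.mult q) ζ → M.pos q = b → γ ≠ M.head q + ζ
      · exact M.single_mem_reducible_of_not_mem_cone hc
      · push Not at hc
        obtain ⟨q, ζ, hζ, rfl, rfl⟩ := hc
        refine ih (toColex ζ) ?_ q hζ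
        have hval : (M.toU (Finsupp.single p (monomial δ 1)) (M.pos q)).coeff (M.head q + ζ) =
            if δ ≤ M.head q + ζ then (M.g p (M.pos q)).coeff (M.head q + ζ - δ) else 0 := by
          simp [toU, coeff_monomial_mul']
        rw [Finsupp.sub_apply, coeff_sub, hval] at hγ
        by_cases hle : δ ≤ M.head q + ζ
        · rw [if_pos hle] at hγ
          -- If `x^δ g_p` does not contribute here, the term must be the subtracted one, which is
          -- impossible because the head of `g_p` has coefficient `1`.
          by_cases h0 : (M.g p (M.pos q)).coeff (M.head q + ζ - δ) = 0
          · exfalso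
            rw [h0, Finsupp.single_apply] at hγ
            split_ifs at hγ with hpq
            · rw [coeff_monomial] at hγ
              split_ifs at hγ with h
              · have := M.cone_disjoint p q δ ζ hpq hx hζ h
                subst this
                rw [← h, add_tsub_cancel_right, M.coeff_head] at h0
                simp [h0] at hγ
              · simp at hγ
            · simp at hγ
          · rcases M.eq_or_toColex_lt hζ hx (add_tsub_cancel_of_le hle) h0 with
              ⟨rfl, rfl, h⟩ | h
            · exfalso
              simp [M.coeff_head] at hγ
            · exact h
        · exfalso
          rw [if_neg hle, Finsupp.single_apply] at hγ
          split_ifs at hγ with hpq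
          · rw [coeff_monomial] at hγ
            split_ifs at hγ with h
            · exact hle (h ▸ le_add_self)
            · simp at hγ
          · simp at hγ
    simpa using M.reducible.sub_mem hmem hdiff

theorem mem_reducible (v : M.B →₀ MvPolynomial (Fin (n + 1)) A) : v ∈ M.reducible := by
  refine M.mem_reducible_of_terms fun b γ _ => ?_
  by_cases hc : ∀ q ζ, VarsLE (M.mult q) ζ → M.pos q = b → γ ≠ M.head q + ζ
  · exact M.single_mem_reducible_of_not_mem_cone hc
  · push Not at hc
    obtain ⟨q, ζ, hζ, rfl, rfl⟩ := hc
    exact M.single_mem_reducible_of_mem_cone (toColex ζ) q hζ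

/-- Reduction only gives agreement on the cones, but the difference then lies in `U` and vanishes on
all cones. -/
theorem exists_isMult_toU_eq {u : M.B →₀ MvPolynomial (Fin (n + 1)) A} (hu : u ∈ M.U) :
    ∃ w, M.IsMult w ∧ M.toU w = u := by
  obtain ⟨w, hw, h⟩ := M.mem_reducible u
  refine ⟨w, hw, sub_eq_zero.1 (M.eq_zero_of_coeff _ (M.U.sub_mem (M.toU_mem w) hu) ?_)⟩
  intro p δ hδ
  rw [Finsupp.sub_apply, coeff_sub, h p δ hδ, sub_self]

theorem range_toU : LinearMap.range M.toU = M.U := by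
  ext u
  constructor
  · rintro ⟨w, rfl⟩
    exact M.toU_mem w
  · intro hu
    obtain ⟨w, -, h⟩ := M.exists_isMult_toU_eq hu
    exact ⟨w, h⟩

/-! ### Homogeneous multiplicative representations. -/

/-- The part of `w` of degree `s`. -/
def degreePart (s : ℕ) (w : M.P →₀ MvPolynomial (Fin (n + 1)) A) :
    M.P →₀ MvPolynomial (Fin (n + 1)) A :=
  Finsupp.equivFunOnFinite.symm fun p =>
    -- Without the guard, truncated subtraction would pick up constant terms of the wrong degree.
    if M.degP p ≤ s then homogeneousComponent (s - M.degP p) (w p) else 0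

theorem coeff_degreePart (s : ℕ) (w : M.P →₀ MvPolynomial (Fin (n + 1)) A) (p : M.P)
    (δ : Fin (n + 1) →₀ ℕ) :
    (M.degreePart s w p).coeff δ = if δ.degree + M.degP p = s then (w p).coeff δ else 0 := by
  classical
  simp only [degreePart, Finsupp.equivFunOnFinite_symm_apply_apply]
  split_ifs with h1 h2 h2
  · rw [coeff_homogeneousComponent, if_pos (by omega)]
  · rw [coeff_homogeneousComponent, if_neg (by omega)]
  · omega
  · simp

/-- A homogeneous element of `U` is the image of a homogeneous multiplicative combination. -/
theorem exists_isMult_degree_toU_eq {u : M.B →₀ MvPolynomial (Fin (n + 1)) A} (hu : u ∈ M.U)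
    {s : ℕ} (hs : ∀ b γ, (u b).coeff γ ≠ 0 → γ.degree + M.degB b = s) :
    ∃ w, M.IsMult w ∧ (∀ p δ, (w p).coeff δ ≠ 0 → δ.degree + M.degP p = s) ∧ M.toU w = u := by
  obtain ⟨w, hw, rfl⟩ := M.exists_isMult_toU_eq hu
  have hdeg : ∀ p δ, (M.degreePart s w p).coeff δ ≠ 0 → δ.degree + M.degP p = s := by
    intro p δ h
    rw [coeff_degreePart] at h
    by_contra h0
    exact h (if_neg h0)
  refine ⟨M.degreePart s w, fun p δ h => ?_, hdeg, ?_⟩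
  · have := hdeg p δ h
    rw [coeff_degreePart, if_pos this] at h
    exact hw p δ h
  · ext b γ
    by_contra hne
    have hne' : (M.toU (w - M.degreePart s w) b).coeff γ ≠ 0 := by
      rw [map_sub, Finsupp.sub_apply, coeff_sub]
      exact sub_ne_zero.2 (Ne.symm hne)
    -- The discarded part contributes only in degrees other than `s`, whereas a discrepancy must sit
    -- in degree `s`.
    have h1 := M.degree_mem_of_coeff_toU_ne_zero {s}ᶜ (fun p δ h => by
      rw [Finsupp.sub_apply, coeff_sub, coeff_degreePart] at h
      intro h0
      exact h (by rw [if_pos (Set.mem_singleton_iff.1 h0), sub_self])) hne'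
    by_cases h0 : (M.toU w b).coeff γ = 0
    · rw [h0] at hne
      exact h1 (M.degree_mem_of_coeff_toU_ne_zero {s} hdeg hne)
    · exact h1 (hs b γ h0)

theorem coeff_single_X (p q : M.P) (k : Fin (n + 1)) (δ : Fin (n + 1) →₀ ℕ) :
    (Finsupp.single p (X k : MvPolynomial (Fin (n + 1)) A) q).coeff δ ≠ 0 →
      p = q ∧ δ = Finsupp.single k 1 := by
  classical
  intro h
  rw [Finsupp.single_apply] at h
  split_ifs at h with hpq
  · rw [coeff_X] at h
    split_ifs at h with hk
    · exact ⟨hpq, hk.symm⟩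
    · simp at h
  · simp at h

theorem exists_isMult_toU_eq_toU_single_X (p : M.P) (k : Fin (n + 1)) :
    ∃ w, M.IsMult w ∧ (∀ q δ, (w q).coeff δ ≠ 0 → δ.degree + M.degP q = M.degP p + 1) ∧
      M.toU w = M.toU (Finsupp.single p (X k)) := by
  refine M.exists_isMult_degree_toU_eq (M.toU_mem _) fun b γ h =>
    M.degree_mem_of_coeff_toU_ne_zero {M.degP p + 1} (fun q δ hδ => ?_) h
  obtain ⟨rfl, rfl⟩ := M.coeff_single_X _ _ _ _ hδ
  simp [add_comm]

/-! ### The marked basis of the syzygy module. -/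

/-- The rewriting of the nonmultiplicative multiple `x_k g_p` by multiplicative multiples. -/
def rewriting (p : M.P) (k : Fin (n + 1)) : M.P →₀ MvPolynomial (Fin (n + 1)) A :=
  (M.exists_isMult_toU_eq_toU_single_X p k).choose

theorem isMult_rewriting (p : M.P) (k : Fin (n + 1)) : M.IsMult (M.rewriting p k) :=
  (M.exists_isMult_toU_eq_toU_single_X p k).choose_spec.1

theorem degree_rewriting (p : M.P) (k : Fin (n + 1)) : ∀ q δ,
    (M.rewriting p k q).coeff δ ≠ 0 → δ.degree + M.degP q = M.degP p + 1 :=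
  (M.exists_isMult_toU_eq_toU_single_X p k).choose_spec.2.1

theorem toU_rewriting (p : M.P) (k : Fin (n + 1)) :
    M.toU (M.rewriting p k) = M.toU (Finsupp.single p (X k)) :=
  (M.exists_isMult_toU_eq_toU_single_X p k).choose_spec.2.2

/-- Shows that the tails of the syzygies avoid every cone of the new heads. -/
theorem coeff_rewriting_eq_zero (p q : M.P) (k : Fin (n + 1)) {l : Fin (n + 1)}
    (hl : M.mult q < l) (δ : Fin (n + 1) →₀ ℕ) :
    (M.rewriting p k q).coeff (Finsupp.single l 1 + δ) = 0 := by
  by_contra h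
  have := (M.isMult_rewriting p k q _ h).eq_zero hl
  simp at this

/-- The syzygies of a marked basis have a marked basis with heads `x_k e_p`, for the
nonmultiplicative variables `x_k` of `p`. -/
def syzygy : MarkedModule n A where
  B := M.P
  P := Σ p : M.P, {k : Fin (n + 1) // M.mult p < k}
  pos x := x.1
  head x := Finsupp.single x.2.1 1
  mult x := x.2.1
  degB := M.degP
  U := LinearMap.ker M.toU
  g x := Finsupp.single x.1 (X x.2.1) - M.rewriting x.1 x.2.1
  head_eq_zero x l hl := Finsupp.single_eq_of_ne hl.ne
  cone_disjoint := by
    rintro ⟨p, k, hk⟩ ⟨q, l, hl⟩ δ ζ (rfl : p = q) (hδ : VarsLE k δ) (hζ : VarsLE l ζ)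
      (h : Finsupp.single k 1 + δ = Finsupp.single l 1 + ζ)
    -- Both `k` and `l` are the largest variable of the common term.
    have hkl : k = l := by
      rcases lt_trichotomy k l with hlt | heq | hlt
      · have := DFunLike.congr_fun h l
        simp [hδ.eq_zero hlt, hlt.ne] at this
        omega
      · exact heq
      · have := DFunLike.congr_fun h k
        simp [hζ.eq_zero hlt, hlt.ne] at this
    subst hkl
    rfl
  g_mem x := by rw [LinearMap.mem_ker, map_sub, M.toU_rewriting, sub_self]
  coeff_head := by
    rintro ⟨p, k, hk⟩
    have := M.coeff_rewriting_eq_zero p p k hk 0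
    rw [add_zero] at this
    simp [this]
  coeff_tail := by
    rintro ⟨p, k, hk⟩ ⟨q, l, hl⟩ δ (hδ : VarsLE l δ) h
    simp only [Finsupp.sub_apply, coeff_sub] at h
    rw [M.coeff_rewriting_eq_zero p q k hl δ, sub_zero] at h
    obtain ⟨rfl, heq⟩ := M.coeff_single_X _ _ _ _ h
    have hlk : l = k := by
      by_contra hlk
      have := DFunLike.congr_fun heq l
      simp [Ne.symm hlk] at this
    subst hlk
    exact ⟨rfl, by simpa using heq⟩
  g_degree := by
    rintro ⟨p, k, hk⟩ q γ h
    simp only [Finsupp.sub_apply, coeff_sub] at h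
    simp only [Finsupp.degree_single]
    rw [add_comm 1]
    by_cases h0 : (M.rewriting p k q).coeff γ = 0
    · rw [h0, sub_zero] at h
      obtain ⟨rfl, rfl⟩ := M.coeff_single_X _ _ _ _ h
      simp [add_comm]
    · exact M.degree_rewriting p k q γ h0
  eq_zero_of_coeff := by
    intro u hu h
    refine M.eq_zero_of_isMult (fun p δ hδ => ?_) hu
    by_contra hm
    -- Every term that is not multiplicative lies in the cone of its largest variable, so vanishing
    -- on the cones makes `u` multiplicative, and uniqueness applies.
    obtain ⟨k, hk, ε, hε, rfl⟩ := exists_eq_single_add_of_not_varsLE hm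
    exact hδ (h ⟨p, k, hk⟩ ε hε)
  exists_coeff_eq := by
    intro v
    obtain ⟨w, hw, h⟩ := M.exists_isMult_toU_eq (M.toU_mem v)
    -- Subtracting the multiplicative representation `w` of the image of `v` gives a syzygy and
    -- changes no coefficient on a cone.
    refine ⟨v - w, by rw [LinearMap.mem_ker, map_sub, h, sub_self], ?_⟩
    rintro ⟨p, k, hk⟩ δ (hδ : VarsLE k δ)
    have : (w p).coeff (Finsupp.single k 1 + δ) = 0 := by
      by_contra h0
      have := (hw p _ h0).eq_zero hk
      simp at this
    simp [this]

/-- The iterated syzygies. -/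
def iterSyzygy : ℕ → MarkedModule n A
  | 0 => M
  | i + 1 => (iterSyzygy i).syzygy

theorem degP_syzygy (x : M.syzygy.P) : M.syzygy.degP x = M.degP x.1 + 1 := by
  simp [degP, syzygy, add_comm]

/-! ### Counting the generators of iterated syzygies. -/

/-- The number of generators of degree `j`, where the generator `p` is counted with the number of
`i`-element sets of nonmultiplicative variables. -/
def weightedCount (i j : ℕ) : ℕ :=
  ∑ p : M.P, if M.degP p = j then (n - M.mult p).choose i else 0

/-- The hockey-stick identity, after the substitution `k ↦ n - k`. Equivalently, `(i+1)`-subsets of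
the variables above `m` are sorted by their smallest element `k`. -/
theorem sum_choose_gt (m : Fin (n + 1)) (i : ℕ) :
    ∑ k : {k : Fin (n + 1) // m < k}, (n - (k : Fin (n + 1))).choose i =
      (n - m).choose (i + 1) := by
  have h1 : ∑ k : {k : Fin (n + 1) // m < k}, (n - (k : Fin (n + 1))).choose i =
      ∑ k ∈ Finset.range (n - m), k.choose i := by
    refine Finset.sum_bij (fun k _ => n - (k : Fin (n + 1))) ?_ ?_ ?_ ?_
    · rintro ⟨k, hk⟩ -
      have := k.2
      rw [Fin.lt_def] at hk
      simp only [Finset.mem_range]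
      omega
    · rintro ⟨k, hk⟩ - ⟨l, hl⟩ - h
      have := k.2
      have := l.2
      simp only at h
      exact Subtype.ext (Fin.ext (by simp only; omega))
    · intro k hk
      rw [Finset.mem_range] at hk
      refine ⟨⟨⟨n - k, by omega⟩, ?_⟩, Finset.mem_univ _, ?_⟩
      · rw [Fin.lt_def]
        simp only
        omega
      · simp only
        omega
    · simp
  rw [h1]
  generalize n - (m : ℕ) = N
  induction N with
  | zero => simp
  | succ N ih => rw [Finset.sum_range_succ, ih, Nat.choose_succ_succ, add_comm]

/-- The binomial weight is chosen so that passing to syzygies merely shifts both indices; this makes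
the ranks of all steps computable from the first. -/
theorem weightedCount_syzygy_succ (i j : ℕ) :
    M.syzygy.weightedCount i (j + 1) = M.weightedCount (i + 1) j := by
  have h : M.syzygy.weightedCount i (j + 1) =
      ∑ x : (Σ p : M.P, {k : Fin (n + 1) // M.mult p < k}),
        if M.degP x.1 = j then (n - (x.2 : Fin (n + 1))).choose i else 0 := by
    refine Fintype.sum_congr _ _ fun x => ?_
    rw [degP_syzygy]
    simp only [add_left_inj]
    rfl
  rw [h, Fintype.sum_sigma, weightedCount]
  refine Fintype.sum_congr _ _ fun p => ?_
  split_ifs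
  · exact sum_choose_gt _ _
  · simp

theorem weightedCount_syzygy_zero (i : ℕ) : M.syzygy.weightedCount i 0 = 0 := by
  refine Finset.sum_eq_zero fun x _ => ?_
  rw [if_neg]
  rw [degP_syzygy]
  omega

theorem weightedCount_iterSyzygy (i l j : ℕ) : (M.iterSyzygy i).weightedCount l j =
    if i ≤ j then M.weightedCount (l + i) (j - i) else 0 := by
  induction i generalizing l j with
  | zero => simp [iterSyzygy]
  | succ i ih =>
    cases j with
    | zero => simp [iterSyzygy, weightedCount_syzygy_zero]
    | succ j =>
      rw [iterSyzygy, weightedCount_syzygy_succ, ih]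
      simp only [add_le_add_iff_right, Nat.add_sub_add_right]
      rw [add_right_comm, add_assoc]

theorem card_degP_eq (j : ℕ) : Nat.card {p : M.P // M.degP p = j} = M.weightedCount 0 j := by
  classical
  simp [weightedCount, Nat.card_eq_fintype_card, Fintype.card_subtype]

/-- A degree-preserving enumeration of the generators. -/
theorem exists_equiv_of_weightedCount (r : ℕ → ℕ) (h : ∀ j, M.weightedCount 0 j = r j) :
    ∃ e : (Σ j, Fin (r j)) ≃ M.P, ∀ x, M.degP (e x) = x.1 := by
  have e : ∀ j, Nonempty (Fin (r j) ≃ {p : M.P // M.degP p = j}) := fun j => by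
    rw [← h, ← card_degP_eq]
    exact ⟨(Finite.equivFin _).symm⟩
  exact ⟨(Equiv.sigmaCongrRight fun j => (e j).some).trans (Equiv.sigmaFiberEquiv M.degP),
    fun x => ((e x.1).some x.2).2⟩

end MarkedModule

/-! ### Degrees read off coefficients. -/

theorem coeff_ne_zero_degree {σ R : Type*} [CommSemiring R] {φ : MvPolynomial σ R} {s : ℕ}
    (h : φ.IsHomogeneous s) {γ : σ →₀ ℕ} (hγ : φ.coeff γ ≠ 0) : γ.degree = s := by
  rw [Finsupp.degree_eq_weight_one]
  exact h hγ

theorem isHomogeneous_of_degree {σ R : Type*} [CommSemiring R] {φ : MvPolynomial σ R} {s : ℕ}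
    (h : ∀ γ, φ.coeff γ ≠ 0 → γ.degree = s) : φ.IsHomogeneous s := by
  intro γ hγ
  have := h γ hγ
  rw [Finsupp.degree_eq_weight_one] at this
  exact this

theorem ShiftedFree.mem_component_iff {n : ℕ} {A : Type*} [CommRing A] (r : ℕ → ℕ) (s : ℕ)
    (v : ShiftedFree n A r) : v ∈ ShiftedFree.component r s ↔
      ∀ p γ, (v p).coeff γ ≠ 0 → γ.degree + p.1 = s := by
  constructor
  · intro h p γ hγ
    by_cases hp : p.1 ≤ s
    · have := coeff_ne_zero_degree ((h p).1 hp) hγ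
      omega
    · rw [(h p).2 (not_le.1 hp)] at hγ
      exact absurd rfl hγ
  · intro h p
    constructor
    · intro hp
      refine isHomogeneous_of_degree fun γ hγ => ?_
      have := h p γ hγ
      omega
    · intro hp
      by_contra hne
      obtain ⟨γ, hγ⟩ := MvPolynomial.ne_zero_iff.1 hne
      have := h p γ hγ
      omega

theorem eq_zero_of_lt_minVar {n : ℕ} {α : Fin (n + 1) →₀ ℕ} {l : Fin (n + 1)}
    (h : l < minVar α) : α l = 0 := by
  by_contra h0
  have hl : l ∈ α.support := Finsupp.mem_support_iff.2 h0
  rw [minVar, dif_pos ⟨l, hl⟩] at h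
  exact absurd (α.support.min'_le l hl) (not_le.2 h)

/-! ### The marked module of an ideal, and the ranks. -/

section

variable {n : ℕ} {A : Type*} [CommRing A] {J : Ideal (MvPolynomial (Fin (n + 1)) A)}
  {P : Finset (Fin (n + 1) →₀ ℕ)} {f : P → MvPolynomial (Fin (n + 1)) A}

theorem IsPommaretBasis.add_mem_termsIn (hP : IsPommaretBasis P J) (p : P)
    {δ : Fin (n + 1) →₀ ℕ} (hδ : VarsLE (minVar (p : Fin (n + 1) →₀ ℕ)) δ) :
    (p : Fin (n + 1) →₀ ℕ) + δ ∈ termsIn J := by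
  rw [← hP.iUnion_cone]
  exact Set.mem_biUnion p.2 ⟨δ, hδ, rfl⟩

theorem IsPommaretBasis.exists_eq_add (hP : IsPommaretBasis P J) {γ : Fin (n + 1) →₀ ℕ}
    (hγ : γ ∈ termsIn J) :
    ∃ (p : P) (δ : _), VarsLE (minVar (p : Fin (n + 1) →₀ ℕ)) δ ∧ γ = p + δ := by
  rw [← hP.iUnion_cone] at hγ
  obtain ⟨α, hα, δ, hδ, rfl⟩ := Set.mem_iUnion₂.1 hγ
  exact ⟨⟨α, hα⟩, δ, hδ, rfl⟩

theorem IsPommaretBasis.eq_of_add_eq_add (hP : IsPommaretBasis P J) (p q : P)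
    {δ ζ : Fin (n + 1) →₀ ℕ} (hδ : VarsLE (minVar (p : Fin (n + 1) →₀ ℕ)) δ)
    (hζ : VarsLE (minVar (q : Fin (n + 1) →₀ ℕ)) ζ)
    (h : (p : Fin (n + 1) →₀ ℕ) + δ = q + ζ) : p = q := by
  by_contra hne
  exact Set.disjoint_left.1 (hP.disjoint_cone p.2 q.2 fun h => hne (Subtype.ext h))
    ⟨δ, hδ, rfl⟩ ⟨ζ, hζ, h⟩

theorem IsMarkedSet.eq_of_coeff_ne_zero (hf : IsMarkedSet P J f) (p : P) {γ : Fin (n + 1) →₀ ℕ}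
    (hγ : γ ∈ termsIn J) (h : (f p).coeff γ ≠ 0) : γ = p := by
  classical
  by_contra hne
  refine hf.tail p γ ?_ hγ
  rw [mem_support_iff, coeff_sub, coeff_monomial, if_neg (Ne.symm hne), sub_zero]
  exact h

theorem mem_normalComponent {φ : MvPolynomial (Fin (n + 1)) A} {s : ℕ}
    (h : ∀ γ, φ.coeff γ ≠ 0 → γ ∉ termsIn J ∧ γ.degree = s) : φ ∈ normalComponent J s := by
  rw [φ.as_sum]
  refine Submodule.sum_mem _ fun γ hγ => ?_
  have := (normalComponent J s).smul_mem (φ.coeff γ)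
    (Submodule.subset_span ⟨γ, h γ (mem_support_iff.1 hγ), rfl⟩)
  rwa [smul_monomial, smul_eq_mul, mul_one] at this

theorem coeff_eq_zero_of_mem_normalComponent {φ : MvPolynomial (Fin (n + 1)) A} {s : ℕ}
    (h : φ ∈ normalComponent J s) {γ : Fin (n + 1) →₀ ℕ} (hγ : γ ∈ termsIn J) :
    φ.coeff γ = 0 := by
  classical
  induction h using Submodule.span_induction with
  | mem x hx =>
    obtain ⟨ζ, hζ, rfl⟩ := hx
    rw [coeff_monomial, if_neg]
    rintro rfl
    exact hζ.1 hγ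
  | zero => simp
  | add x y _ _ hx hy => rw [coeff_add, hx, hy, add_zero]
  | smul a x _ hx => rw [coeff_smul, hx, smul_zero]

theorem IsMarkedSet.homogeneousComponent_mem (hf : IsMarkedSet P J f)
    {φ : MvPolynomial (Fin (n + 1)) A} (hφ : φ ∈ Ideal.span (Set.range f)) (s : ℕ) :
    homogeneousComponent s φ ∈ Ideal.span (Set.range f) := by
  let _ := MvPolynomial.gradedAlgebra (σ := Fin (n + 1)) (R := A)
  have h : (Ideal.span (Set.range f)).IsHomogeneous (homogeneousSubmodule (Fin (n + 1)) A) := by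
    apply Ideal.homogeneous_span
    rintro _ ⟨p, rfl⟩
    exact ⟨_, hf.homogeneous p⟩
  rw [← decomposition.decompose'_apply φ s]
  exact h s hφ

/-- Each homogeneous component lies both in the ideal and in the span of the terms outside `J`, so
directness in each degree kills it. -/
theorem IsMarkedBasis.eq_zero_of_coeff (hf : IsMarkedBasis P J f)
    {φ : MvPolynomial (Fin (n + 1)) A} (hφ : φ ∈ Ideal.span (Set.range f))
    (h : ∀ γ ∈ termsIn J, φ.coeff γ = 0) : φ = 0 := by
  rw [← sum_homogeneousComponent φ]
  refine Finset.sum_eq_zero fun s _ => ?_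
  refine Submodule.disjoint_def.1 (hf.disjoint s) _
    ⟨hf.toIsMarkedSet.homogeneousComponent_mem hφ s, homogeneousComponent_mem s φ⟩
    (mem_normalComponent fun γ hγ => ?_)
  rw [coeff_homogeneousComponent] at hγ
  split_ifs at hγ with hs
  · exact ⟨fun hJ => hγ (h γ hJ), hs⟩
  · exact absurd rfl hγ

/-- Split each homogeneous component by `sup_eq`; its normal part is invisible on the terms of `J`.
-/
theorem IsMarkedBasis.exists_coeff_eq (hf : IsMarkedBasis P J f)
    (φ : MvPolynomial (Fin (n + 1)) A) :
    ∃ ψ ∈ Ideal.span (Set.range f), ∀ γ ∈ termsIn J, ψ.coeff γ = φ.coeff γ := by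
  have h : ∀ s, ∃ ψ ∈ Ideal.span (Set.range f), ∀ γ ∈ termsIn J,
      ψ.coeff γ = (homogeneousComponent s φ).coeff γ := by
    intro s
    have hs : homogeneousComponent s φ ∈ homogeneousSubmodule (Fin (n + 1)) A s :=
      homogeneousComponent_mem s φ
    rw [← hf.sup_eq s] at hs
    obtain ⟨ψ, hψ, ν, hν, heq⟩ := Submodule.mem_sup.1 hs
    refine ⟨ψ, hψ.1, fun γ hγ => ?_⟩
    rw [← heq, coeff_add, coeff_eq_zero_of_mem_normalComponent hν hγ, add_zero]
  choose ψ hψ hc using h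
  refine ⟨∑ s ∈ Finset.range (φ.totalDegree + 1), ψ s,
    Submodule.sum_mem _ fun s _ => hψ s, fun γ hγ => ?_⟩
  conv_rhs => rw [← sum_homogeneousComponent φ]
  rw [coeff_sum, coeff_sum]
  exact Finset.sum_congr rfl fun s _ => hc s γ hγ

/-- The marked module of an ideal generated by a marked basis. -/
def IsMarkedBasis.markedModule (hf : IsMarkedBasis P J f) (hP : IsPommaretBasis P J) :
    MarkedModule n A where
  B := Unit
  P := P
  pos _ := ()
  head p := p
  mult p := minVar (p : Fin (n + 1) →₀ ℕ)
  degB _ := 0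
  U := Submodule.comap (Finsupp.lapply ()) (Ideal.span (Set.range f))
  g p := Finsupp.single () (f p)
  head_eq_zero _ _ h := eq_zero_of_lt_minVar h
  cone_disjoint p q _ _ _ hδ hζ h := hP.eq_of_add_eq_add p q hδ hζ h
  g_mem p := by simpa using Ideal.subset_span (Set.mem_range_self p)
  coeff_head p := by simpa using hf.head_coeff p
  coeff_tail p q δ hδ h := by
    rw [Finsupp.single_eq_same] at h
    have heq := hf.toIsMarkedSet.eq_of_coeff_ne_zero p (hP.add_mem_termsIn q hδ) h
    -- The head of `p` lies in its own cone with cofactor `1`, so disjointness identifies the two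
    -- generators.
    have hqp : q = p := hP.eq_of_add_eq_add q p hδ (VarsLE.zero _) (by rw [heq, add_zero])
    subst hqp
    exact ⟨rfl, by simpa using heq⟩
  g_degree p b γ h := by
    rw [Finsupp.single_eq_same] at h
    rw [coeff_ne_zero_degree (hf.homogeneous p) h]
  eq_zero_of_coeff u hu h := by
    refine Finsupp.ext fun b => hf.eq_zero_of_coeff hu fun γ hγ => ?_
    obtain ⟨p, δ, hδ, rfl⟩ := hP.exists_eq_add hγ
    exact h p δ hδ
  exists_coeff_eq v := by
    obtain ⟨ψ, hψ, h⟩ := hf.exists_coeff_eq (v ())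
    refine ⟨Finsupp.single () ψ, by simpa using hψ, fun p δ hδ => ?_⟩
    rw [Finsupp.single_eq_same]
    exact h _ (hP.add_mem_termsIn p hδ)

theorem IsMarkedBasis.weightedCount_markedModule (hf : IsMarkedBasis P J f)
    (hP : IsPommaretBasis P J) (i j : ℕ) : (hf.markedModule hP).weightedCount i j =
      ∑ α ∈ P, if α.degree = j then (n - minVar α).choose i else 0 :=
  Finset.sum_coe_sort P fun α => if α.degree = j then (n - minVar α : ℕ).choose i else 0

theorem sum_choose_minVar (P : Finset (Fin (n + 1) →₀ ℕ)) (i j : ℕ) :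
    (∑ α ∈ P, if α.degree = j then (n - minVar α : ℕ).choose i else 0) =
      ∑ k ∈ Finset.range (n + 1 - i), (n - k).choose i * termCount P k j := by
  simp only [termCount, Finset.card_filter, Finset.mul_sum]
  rw [Finset.sum_comm]
  refine Finset.sum_congr rfl fun α _ => ?_
  by_cases hj : α.degree = j
  · simp only [hj, true_and, if_true, mul_ite, mul_one, mul_zero, Finset.sum_ite_eq,
      Finset.mem_range]
    split_ifs with h
    · rfl
    -- The range omits the indices `k > n - i`, for which the binomial coefficient vanishes.
    · have := (minVar α).2
      exact Nat.choose_eq_zero_of_lt (by omega)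
  · simp [hj]

theorem IsMarkedBasis.weightedCount_iterSyzygy (hf : IsMarkedBasis P J f)
    (hP : IsPommaretBasis P J) (i j : ℕ) :
    ((hf.markedModule hP).iterSyzygy i).weightedCount 0 j = resolutionRank P i j := by
  rw [MarkedModule.weightedCount_iterSyzygy, zero_add, hf.weightedCount_markedModule,
    sum_choose_minVar, resolutionRank]

theorem resolutionRank_eq_zero {D : Fin (n + 1)}
    (hD : IsLeast (minVar '' (P : Set (Fin (n + 1) →₀ ℕ))) D) {i : ℕ} (hi : n - (D : ℕ) < i)
    (j : ℕ) : resolutionRank P i j = 0 := by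
  rw [resolutionRank, ← sum_choose_minVar]
  split_ifs
  · refine Finset.sum_eq_zero fun α hα => ?_
    have : (D : ℕ) ≤ minVar α := hD.2 ⟨α, hα, rfl⟩
    rw [Nat.choose_eq_zero_of_lt (by omega), ite_self]
  · rfl

theorem exists_resolutionRank_ne_zero {D : Fin (n + 1)}
    (hD : IsLeast (minVar '' (P : Set (Fin (n + 1) →₀ ℕ))) D) :
    ∃ j, resolutionRank P (n - (D : ℕ)) j ≠ 0 := by
  obtain ⟨α, hα, rfl⟩ := hD.1
  -- A term attaining `D` contributes `C(n-D, n-D) = 1`, in its degree raised by `n - D`.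
  refine ⟨n - minVar α + α.degree, ?_⟩
  rw [resolutionRank, ← sum_choose_minVar, if_pos (Nat.le_add_right _ _), add_tsub_cancel_left]
  refine (Finset.sum_pos' (fun _ _ => Nat.zero_le _) ⟨α, hα, ?_⟩).ne'
  simp

end

/-! ### Assembling the resolution. -/

namespace MarkedModule

variable {n : ℕ} {A : Type*} [CommRing A] (M : MarkedModule n A)

/-- The differential from the `(i+1)`-st to the `i`-th syzygy generators. -/
def syzygyMap (i : ℕ) : ((M.iterSyzygy (i + 1)).P →₀ MvPolynomial (Fin (n + 1)) A)
    →ₗ[MvPolynomial (Fin (n + 1)) A] ((M.iterSyzygy i).P →₀ MvPolynomial (Fin (n + 1)) A) :=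
  (M.iterSyzygy (i + 1)).toU

theorem range_syzygyMap (i : ℕ) :
    LinearMap.range (M.syzygyMap i) = LinearMap.ker (M.iterSyzygy i).toU :=
  (M.iterSyzygy (i + 1)).range_toU

theorem exact_syzygyMap (i : ℕ) : Function.Exact (M.syzygyMap (i + 1)) (M.syzygyMap i) :=
  LinearMap.exact_iff.2 (M.range_syzygyMap (i + 1)).symm

theorem degree_syzygyMap (i s : ℕ) {w : (M.iterSyzygy (i + 1)).P →₀ MvPolynomial (Fin (n + 1)) A}
    (hw : ∀ p δ, (w p).coeff δ ≠ 0 → δ.degree + (M.iterSyzygy (i + 1)).degP p = s)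
    (p : (M.iterSyzygy i).P) (γ : Fin (n + 1) →₀ ℕ) (h : (M.syzygyMap i w p).coeff γ ≠ 0) :
    γ.degree + (M.iterSyzygy i).degP p = s :=
  (M.iterSyzygy (i + 1)).degree_mem_of_coeff_toU_ne_zero {s} hw h

end MarkedModule

end

/-- The graded free resolution, of length `n - D` and with ranks `r_{i,j}`, of an ideal generated by
a marked basis over the Pommaret basis `P` of a quasi-stable monomial ideal `J`. -/
theorem mainTheorem2 {K : Type*} [Field K] {A : Type*} [CommRing A] [Algebra K A]
    [IsNoetherianRing A] {n : ℕ} (J : Ideal (MvPolynomial (Fin (n + 1)) A))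
    (P : Finset (Fin (n + 1) →₀ ℕ)) (hP : IsPommaretBasis P J)
    (f : P → MvPolynomial (Fin (n + 1)) A) (hf : IsMarkedBasis P J f)
    (D : Fin (n + 1)) (hD : IsLeast (minVar '' (P : Set (Fin (n + 1) →₀ ℕ))) D) :
    ∃ (ε : ShiftedFree n A (resolutionRank P 0) →ₗ[MvPolynomial (Fin (n + 1)) A]
          (Ideal.span (Set.range f)))
      (d : ∀ i, ShiftedFree n A (resolutionRank P (i + 1)) →ₗ[MvPolynomial (Fin (n + 1)) A]
          ShiftedFree n A (resolutionRank P i)),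
      IsGradedFreeResolution (Ideal.span (Set.range f)) (resolutionRank P) (n - (D : ℕ)) ε d := by
  set M := hf.markedModule hP
  have he := fun i => (M.iterSyzygy i).exists_equiv_of_weightedCount _
    (hf.weightedCount_iterSyzygy hP i)
  choose e he using he
  -- Relabelling along the degree-preserving bijections `e i` carries the complex of syzygy maps to
  -- the shifted free modules.
  let T : ∀ i, ShiftedFree n A (resolutionRank P i) ≃ₗ[MvPolynomial (Fin (n + 1)) A]
      ((M.iterSyzygy i).P →₀ MvPolynomial (Fin (n + 1)) A) := fun i => Finsupp.domLCongr (e i)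
  have hT : ∀ i w p, T i w (e i p) = w p := fun i w p => by simp [T]
  have hTs : ∀ i w p, (T i).symm w p = w (e i p) := fun i w p => by
    rw [← hT, LinearEquiv.apply_symm_apply]
  have hdeg : ∀ i s w, w ∈ ShiftedFree.component (resolutionRank P i) s →
      ∀ p δ, (T i w p).coeff δ ≠ 0 →
        δ.degree + (M.iterSyzygy i).degP p = s := by
    intro i s w hw p δ h
    obtain ⟨x, rfl⟩ := (e i).surjective p
    rw [hT] at h
    rw [he]
    exact (ShiftedFree.mem_component_iff _ _ _).1 hw x δ h
  -- The ambient free module has rank one, with basis `Unit`; its single coordinate identifies `M.U`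
  -- with the ideal.
  let ε₀ : ((M.iterSyzygy 0).P →₀ MvPolynomial (Fin (n + 1)) A) →ₗ[MvPolynomial (Fin (n + 1)) A]
      (Ideal.span (Set.range f)) :=
    LinearMap.codRestrict _ (Finsupp.lapply () ∘ₗ M.toU) fun w => M.toU_mem w
  have hε₀ : ∀ w, ε₀ w = 0 ↔ (M.iterSyzygy 0).toU w = 0 := fun w => by
    rw [← Subtype.coe_inj]
    exact ⟨fun h => Finsupp.ext fun _ => h, fun h => DFunLike.congr_fun h ()⟩
  refine ⟨ε₀ ∘ₗ (T 0).toLinearMap,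
    fun i => (T i).symm.toLinearMap ∘ₗ M.syzygyMap i ∘ₗ (T (i + 1)).toLinearMap, ?_⟩
  constructor
  case finite_rank => exact fun i => Finite.of_equiv _ (e i).symm
  case augmentation_degree =>
    intro s v hv
    refine isHomogeneous_of_degree fun γ hγ => ?_
    exact M.degree_mem_of_coeff_toU_ne_zero {s} (hdeg 0 s v hv) hγ
  case differential_degree =>
    intro i s v hv
    rw [ShiftedFree.mem_component_iff]
    intro p γ h
    simp only [LinearMap.comp_apply, LinearEquiv.coe_coe, hTs] at h
    rw [← he]
    exact M.degree_syzygyMap i s (hdeg (i + 1) s v hv) _ γ h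
  case augmentation_surjective =>
    rintro ⟨φ, hφ⟩
    have hmem : (Finsupp.single () φ : Unit →₀ MvPolynomial (Fin (n + 1)) A) ∈ M.U := by
      change (Finsupp.single () φ : Unit →₀ MvPolynomial (Fin (n + 1)) A) () ∈
        Ideal.span (Set.range f)
      rwa [Finsupp.single_eq_same]
    obtain ⟨w, -, hw⟩ := (M.iterSyzygy 0).exists_isMult_toU_eq hmem
    refine ⟨(T 0).symm w, ?_⟩
    rw [LinearMap.comp_apply, LinearEquiv.coe_coe, LinearEquiv.apply_symm_apply]
    exact Subtype.ext ((DFunLike.congr_fun hw ()).trans Finsupp.single_eq_same)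
  case exact_zero =>
    intro w
    simp only [LinearMap.comp_apply, LinearEquiv.coe_coe, Set.mem_range]
    refine (hε₀ _).trans ?_
    have := M.range_syzygyMap 0
    constructor
    · intro h
      obtain ⟨v, hv⟩ : T 0 w ∈ LinearMap.range (M.syzygyMap 0) := this ▸ h
      exact ⟨(T 1).symm v, by
        rw [LinearEquiv.apply_symm_apply, hv, LinearEquiv.symm_apply_apply]⟩
    · rintro ⟨v, rfl⟩
      rw [LinearEquiv.apply_symm_apply]
      have h : M.syzygyMap 0 (T 1 v) ∈ LinearMap.range (M.syzygyMap 0) := ⟨_, rfl⟩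
      rw [this] at h
      exact h
  case exact_succ =>
    intro i w
    simp only [LinearMap.comp_apply, LinearEquiv.coe_coe, Set.mem_range,
      LinearEquiv.map_eq_zero_iff]
    refine (M.exact_syzygyMap i _).trans ?_
    constructor
    · rintro ⟨v, hv⟩
      exact ⟨(T (i + 2)).symm v, by
        rw [LinearEquiv.apply_symm_apply, hv, LinearEquiv.symm_apply_apply]⟩
    · rintro ⟨v, rfl⟩
      exact ⟨_, (LinearEquiv.apply_symm_apply _ _).symm⟩
  case top_ne_zero => exact exists_resolutionRank_ne_zero hD
  case eq_zero_of_gt => exact fun i hi j => resolutionRank_eq_zero hD hi j
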